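/- For $0<u\le 1$ let $\zeta(s,u)$ be the Hurwitz zeta function (the meromorphic continuation of $\sum_{n\ge 0}(n+u)^{-s}$), let $\zeta'(s,u)=\frac{\partial}{\partial s}\zeta(s,u)$, and let the Stieltjes constants $\gamma_n(u)$ be defined by the Laurent expansion $$\zeta(s,u)=\frac1{s-1}+\sum_{n=0}^{\infty}\frac{(-1)^n}{n!}\gamma_n(u)(s-1)^n .$$ Write $\gamma$ for Euler's constant. Then for all positive integers $p<q$ the Almkvist–Meurman formula holds: $$\lim_{s\to1}\left[\zeta'\!\left(s,\tfrac pq\right)-\zeta'\!\left(s,1-\tfrac pq\right)\right]=\pi\,[\log(2\pi q)+\gamma]\cot\!\left(\frac{\pi p}{q}\right)-2\pi\sum_{j=1}^{q-1}\log\Gamma\!\left(\frac jq\right)\sin\!\left(\frac{2\pi jp}{q}\right),$$ where $s\to1$ through complex $s\ne1$ (the left side is what is denoted $\zeta'(1,\frac pq)-\zeta'(1,1-\frac pq)$). Equivalently, $$\gamma_1\!\left(\tfrac pq\right)-\gamma_1\!\left(1-\tfrac pq\right)=-\pi\,[\log(2\pi q)+\gamma]\cot\!\left(\frac{\pi p}{q}\right)+2\pi\sum_{j=1}^{q-1}\log\Gamma\!\left(\frac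 jq\right)\sin\!\left(\frac{2\pi jp}{q}\right).$$ -/

import Mathlib

open Filter Topology

/-- The Hurwitz zeta function `ζ(s, u)` with its polar part `1 / (s - 1)` removed; at `s = 1` the
value is filled in by the limit. Meant for `0 < u ≤ 1`, where `HurwitzZeta.hurwitzZeta u` is the
meromorphic continuation of `∑ n, 1 / (n + u) ^ s`. -/
noncomputable def hurwitzRegularPart (u : ℝ) : ℂ → ℂ :=
  Function.update (fun s : ℂ => HurwitzZeta.hurwitzZeta (u : UnitAddCircle) s - 1 / (s - 1)) 1
    (limUnder (𝓝[≠] (1 : ℂ))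
      (fun s : ℂ => HurwitzZeta.hurwitzZeta (u : UnitAddCircle) s - 1 / (s - 1)))

/-- The generalised Stieltjes constant `γ_n(u)`, `0 < u ≤ 1`: the number such that the coefficient
of `(s - 1) ^ n` in the Laurent expansion of `ζ(s, u)` about `s = 1` is `(-1) ^ n / n! * γ_n(u)`
(see `hasSum_hurwitzZeta_laurent`). -/
noncomputable def stieltjesConst (n : ℕ) (u : ℝ) : ℂ :=
  (-1) ^ n * iteratedDeriv n (hurwitzRegularPart u) 1

theorem differentiable_hurwitzRegularPart (u : ℝ) : Differentiable ℂ (hurwitzRegularPart u) := by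
  have hd : DifferentiableOn ℂ
      (fun s : ℂ => HurwitzZeta.hurwitzZeta (u : UnitAddCircle) s - 1 / (s - 1))
      (Set.univ \ {1}) := by
    intro s hs
    have hs1 : s ≠ 1 := by simpa using hs
    refine DifferentiableAt.differentiableWithinAt ?_
    refine (HurwitzZeta.differentiableAt_hurwitzZeta _ hs1).sub ?_
    exact (differentiableAt_const _).div (by fun_prop) (sub_ne_zero.mpr hs1)
  have ho : (fun s : ℂ => (HurwitzZeta.hurwitzZeta (u : UnitAddCircle) s - 1 / (s - 1)) -
      (HurwitzZeta.hurwitzZeta (u : UnitAddCircle) 1 - 1 / ((1 : ℂ) - 1)))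
      =o[𝓝[≠] (1 : ℂ)] fun s => (s - 1)⁻¹ := by
    refine Asymptotics.isLittleO_of_tendsto' ?_ ?_
    · filter_upwards [self_mem_nhdsWithin] with s hs h
      exact absurd h (inv_ne_zero (sub_ne_zero.mpr hs))
    · have h0 : Tendsto (fun s : ℂ => s - 1) (𝓝[≠] (1 : ℂ)) (𝓝 0) := by
        have : Tendsto (fun s : ℂ => s - 1) (𝓝 (1 : ℂ)) (𝓝 (1 - 1)) :=
          (continuous_id.sub continuous_const).tendsto _
        rw [sub_self] at this
        exact this.mono_left nhdsWithin_le_nhds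
      have h1 := ((HurwitzZeta.hurwitzZeta_residue_one (u : UnitAddCircle)).sub_const 1).sub
        (h0.mul_const (HurwitzZeta.hurwitzZeta (u : UnitAddCircle) 1))
      rw [sub_self, zero_mul, sub_zero] at h1
      refine h1.congr' ?_
      filter_upwards [self_mem_nhdsWithin] with s hs
      have : s - 1 ≠ 0 := sub_ne_zero.mpr hs
      rw [sub_self, div_zero, sub_zero]
      field_simp
  have := Complex.differentiableOn_update_limUnder_of_isLittleO (s := Set.univ) univ_mem hd ho
  exact differentiableOn_univ.mp this

/-- The Laurent expansion about `s = 1` that characterises the Stieltjes constants. -/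
theorem hasSum_hurwitzZeta_laurent (u : ℝ) {s : ℂ} (hs : s ≠ 1) :
    HasSum (fun n : ℕ => (-1) ^ n / (n.factorial : ℂ) * stieltjesConst n u * (s - 1) ^ n)
      (HurwitzZeta.hurwitzZeta (u : UnitAddCircle) s - 1 / (s - 1)) := by
  have h := Complex.hasSum_taylorSeries_of_entire (differentiable_hurwitzRegularPart u) 1 s
  have e : hurwitzRegularPart u s
      = HurwitzZeta.hurwitzZeta (u : UnitAddCircle) s - 1 / (s - 1) := by
    simp [hurwitzRegularPart, Function.update_of_ne hs]
  rw [← e]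
  have hf : (fun n : ℕ => (-1) ^ n / (n.factorial : ℂ) * stieltjesConst n u * (s - 1) ^ n) =
      fun n : ℕ => (n.factorial : ℂ)⁻¹ • (s - 1) ^ n •
        iteratedDeriv n (hurwitzRegularPart u) 1 := by
    funext n
    have h2 : ((-1 : ℂ) ^ n) * (-1) ^ n = 1 := by rw [← mul_pow]; simp
    simp only [stieltjesConst, smul_eq_mul]
    linear_combination
      ((n.factorial : ℂ)⁻¹ * iteratedDeriv n (hurwitzRegularPart u) 1 * (s - 1) ^ n) * h2
  rw [hf]
  exact h

/-! The polar parts of `ζ(s,u)` and `ζ(s,1-u)` cancel: their difference is the entire function `2 *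
hurwitzZetaOdd u s`. Both claims therefore reduce to its derivative at `s = 1`
(`two_mul_deriv_hurwitzZetaOdd_one`). The functional equation, differentiated at its regular point,
moves this to the value and derivative of `sinZeta` at `0`. For `u = p/q`, `sinZeta` is `q ^ (-s)`
times a sine-weighted sum of the functions `hurwitzZetaOdd (j/q)` (`sinZeta_div_eq_sum`). Two
evaluations finish the proof: the cotangent expansion gives `2 * hurwitzZetaOdd x 1`, hence
`sinZeta` at `0`, and a Lerch-type formula gives the derivative of `hurwitzZetaOdd x` at `0` in
terms of `log Γ`. Both are read off one series valid for `-1/2 < re s` near `0`, whose terms are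
corrected to annihilate affine functions and so gain two powers of `n`. -/

/-! ### A series for the odd Hurwitz zeta function beyond its half-plane of convergence -/

/-- A second-difference estimate. -/
theorem norm_sub_sub_mul_sub_le {f f' f'' : ℝ → ℂ} {S : Set ℝ} {M x y : ℝ} (hS : Convex ℝ S)
    (hf : ∀ t ∈ S, HasDerivAt f (f' t) t) (hf' : ∀ t ∈ S, HasDerivAt f' (f'' t) t)
    (hM : ∀ t ∈ S, ‖f'' t‖ ≤ M) (hS2 : ∀ t ∈ S, ∀ u ∈ S, |t - u| ≤ 2)
    (hx : x ∈ S) (hy : y ∈ S) (h1 : (1 : ℝ) ∈ S) (h2 : (2 : ℝ) ∈ S) :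
    ‖f x - f y - ((y : ℂ) - x) * (f 1 - f 2)‖ ≤ 4 * M := by
  have hM0 : 0 ≤ M := (norm_nonneg _).trans (hM x hx)
  have hd : ∀ t ∈ S, ∀ u ∈ S, ‖f' u - f' t‖ ≤ 2 * M := fun t ht u hu => by
    refine (hS.norm_image_sub_le_of_norm_hasDerivWithin_le
      (fun v hv => (hf' v hv).hasDerivWithinAt) hM ht hu).trans ?_
    rw [mul_comm, Real.norm_eq_abs]
    exact mul_le_mul_of_nonneg_right (hS2 u hu t ht) hM0
  -- `f 2 - f 1` is the mean slope on `[1, 2]`, so it differs from any `f' t` by at most the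
  -- oscillation of `f'`.
  have hd2 : ∀ t ∈ S, ‖f' t + (f 1 - f 2)‖ ≤ 2 * M := fun t ht => by
    have hk : ∀ v ∈ S, HasDerivWithinAt (fun v : ℝ => f v - (v : ℂ) * f' t) (f' v - f' t) S v :=
      fun v hv => by
        have := (hf v hv).fun_sub ((Complex.ofRealCLM.hasDerivAt (x := v)).mul_const (f' t))
        simpa using this.hasDerivWithinAt
    have := hS.norm_image_sub_le_of_norm_hasDerivWithin_le hk (fun v hv => hd t ht v hv) h2 h1
    norm_num at this
    refine le_trans (le_of_eq ?_) this
    congr 1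
    ring
  have hh : ∀ v ∈ S, HasDerivWithinAt (fun v : ℝ => f v + (v : ℂ) * (f 1 - f 2))
      (f' v + (f 1 - f 2)) S v := fun v hv => by
    have := (hf v hv).fun_add ((Complex.ofRealCLM.hasDerivAt (x := v)).mul_const (f 1 - f 2))
    simpa using this.hasDerivWithinAt
  have := hS.norm_image_sub_le_of_norm_hasDerivWithin_le hh hd2 hy hx
  calc _ = ‖f x + (x : ℂ) * (f 1 - f 2) - (f y + (y : ℂ) * (f 1 - f 2))‖ := by congr 1; ring
    _ ≤ _ := this
    _ ≤ 2 * M * 2 := by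
      rw [Real.norm_eq_abs]
      exact mul_le_mul_of_nonneg_left (hS2 x hx y hy) (by positivity)
    _ = _ := by ring

/-- The terms of a series which represents `2 * hurwitzZetaOdd x s - (1 - 2 * x)` to the left of
the half-plane of convergence of the Dirichlet series. -/
noncomputable def oddTerm (x : ℝ) (n : ℕ) (s : ℂ) : ℂ :=
  ((n + x : ℝ) : ℂ) ^ (-s) - ((n + (1 - x) : ℝ) : ℂ) ^ (-s) -
    (((1 - x : ℝ) : ℂ) - x) * (((n + 1 : ℝ) : ℂ) ^ (-s) - ((n + 2 : ℝ) : ℂ) ^ (-s))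

theorem hasDerivAt_add_cpow {n t : ℝ} (h : 0 < n + t) (s : ℂ) :
    HasDerivAt (fun t : ℝ => ((n + t : ℝ) : ℂ) ^ s) (s * ((n + t : ℝ) : ℂ) ^ (s - 1)) t := by
  have h1 : HasDerivAt (fun z : ℂ => ((n : ℂ) + z) ^ s) (s * ((n : ℂ) + t) ^ (s - 1) * 1) (t : ℂ) :=
    ((hasDerivAt_id (t : ℂ)).const_add (n : ℂ)).cpow_const (by
      exact Or.inl (by simpa using h))
  simpa using h1.comp_ofReal

/-- A convex open set on which the series of `oddTerm` is dominated. -/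
def oddDomain : Set ℂ := {s | -1 / 2 < s.re} ∩ Metric.ball 0 3

theorem isOpen_oddDomain : IsOpen oddDomain :=
  (isOpen_lt continuous_const Complex.continuous_re).inter Metric.isOpen_ball

theorem isPreconnected_oddDomain : IsPreconnected oddDomain :=
  ((convex_halfSpace_re_gt _).inter (convex_ball _ _)).isPreconnected

theorem norm_oddTerm_le {x : ℝ} (hx : 0 < x) (hx1 : x < 1) (n : ℕ) {s : ℂ} (hs : s ∈ oddDomain) :
    ‖oddTerm x n s‖ ≤ 48 * (min x (1 - x)) ^ (-5 : ℝ) * ((n : ℝ) + 1) ^ (-(3 / 2) : ℝ) := by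
  set m := min x (1 - x) with hm
  have hm0 : 0 < m := lt_min hx (by linarith)
  have hmx : m ≤ x := min_le_left _ _
  have hm1x : m ≤ 1 - x := min_le_right _ _
  have hsre : -1 / 2 < s.re := hs.1
  have hsn : ‖s‖ < 3 := by simpa using hs.2
  have hsre3 : s.re < 3 := (Complex.re_le_norm s).trans_lt hsn
  have hn0 : (0 : ℝ) ≤ n := n.cast_nonneg
  have key := norm_sub_sub_mul_sub_le (S := Set.Icc m 2) (x := x) (y := 1 - x)
    (f := fun t : ℝ => ((n + t : ℝ) : ℂ) ^ (-s))
    (f' := fun t : ℝ => -s * ((n + t : ℝ) : ℂ) ^ (-s - 1))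
    (f'' := fun t : ℝ => -s * ((-s - 1) * ((n + t : ℝ) : ℂ) ^ (-s - 1 - 1)))
    -- `12 = 3 * 4` bounds `‖s‖ * ‖s + 1‖`; the exponents come from `3/2 < re s + 2 < 5`, with `m *
    -- (n + 1) ≤ n + t`.
    (M := 12 * (m ^ (-5 : ℝ) * ((n : ℝ) + 1) ^ (-(3 / 2) : ℝ)))
    (convex_Icc _ _)
    (fun t ht => hasDerivAt_add_cpow (by linarith [ht.1]) _)
    (fun t ht => (hasDerivAt_add_cpow (by linarith [ht.1]) _).const_mul _)
    (fun t ht => ?_) (fun t ht u hu => ?_) ⟨hmx, by linarith⟩ ⟨hm1x, by linarith⟩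
    ⟨by linarith, by norm_num⟩ ⟨by linarith, le_rfl⟩
  · refine key.trans (le_of_eq (by ring))
  · have hpos : 0 < (n : ℝ) + t := by linarith [ht.1]
    rw [norm_mul, norm_mul, Complex.norm_cpow_eq_rpow_re_of_pos hpos, norm_neg, ← mul_assoc]
    have e1 : ‖s‖ * ‖-s - 1‖ ≤ 12 := by
      have : ‖-s - 1‖ ≤ ‖s‖ + 1 := by simpa using norm_sub_le (-s) 1
      nlinarith [norm_nonneg s, norm_nonneg (-s - 1)]
    refine mul_le_mul e1 ?_ (by positivity) (by norm_num)
    have e2 : (-s - 1 - 1).re = -(s.re + 2) := by simp; ring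
    rw [e2]
    have hle : m * ((n : ℝ) + 1) ≤ n + t := by nlinarith [ht.1]
    calc ((n : ℝ) + t) ^ (-(s.re + 2)) ≤ (m * ((n : ℝ) + 1)) ^ (-(s.re + 2)) :=
          Real.rpow_le_rpow_of_nonpos (by positivity) hle (by linarith)
      _ = m ^ (-(s.re + 2)) * ((n : ℝ) + 1) ^ (-(s.re + 2)) :=
          Real.mul_rpow hm0.le (by positivity)
      _ ≤ _ := by
          refine mul_le_mul ?_ ?_ (by positivity) (by positivity)
          · exact Real.rpow_le_rpow_of_exponent_ge hm0 (by linarith) (by linarith)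
          · exact Real.rpow_le_rpow_of_exponent_le (by linarith) (by linarith)
  · rw [abs_le]; constructor <;> linarith [ht.1, ht.2, hu.1, hu.2]

theorem summable_oddTerm_bound (x : ℝ) :
    Summable fun n : ℕ =>
      48 * (min x (1 - x)) ^ (-5 : ℝ) * ((n : ℝ) + 1) ^ (-(3 / 2) : ℝ) := by
  refine Summable.mul_left _ ?_
  have := (summable_nat_add_iff 1).mpr
    (Real.summable_nat_rpow.mpr (by norm_num : (-(3 / 2) : ℝ) < -1))
  simpa using this

theorem hasDerivAt_ofReal_cpow_neg {a : ℝ} (ha : 0 < a) (s : ℂ) :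
    HasDerivAt (fun s : ℂ => (a : ℂ) ^ (-s)) (-(Real.log a * (a : ℂ) ^ (-s))) s := by
  have := (hasDerivAt_neg s).const_cpow (c := (a : ℂ)) (Or.inl (by exact_mod_cast ha.ne'))
  rw [← Complex.ofReal_log ha.le] at this
  convert! this using 1
  ring

theorem hasDerivAt_oddTerm {x : ℝ} (hx : 0 < x) (hx1 : x < 1) (n : ℕ) (s : ℂ) :
    HasDerivAt (oddTerm x n)
      (-(Real.log (n + x) * ((n + x : ℝ) : ℂ) ^ (-s)) -
        -(Real.log (n + (1 - x)) * ((n + (1 - x) : ℝ) : ℂ) ^ (-s)) -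
      (((1 - x : ℝ) : ℂ) - x) * (-(Real.log (n + 1) * ((n + 1 : ℝ) : ℂ) ^ (-s)) -
        -(Real.log (n + 2) * ((n + 2 : ℝ) : ℂ) ^ (-s)))) s := by
  have hn0 : (0 : ℝ) ≤ n := n.cast_nonneg
  exact ((hasDerivAt_ofReal_cpow_neg (by linarith) s).sub
    (hasDerivAt_ofReal_cpow_neg (by linarith) s)).sub
    (((hasDerivAt_ofReal_cpow_neg (by linarith) s).sub
    (hasDerivAt_ofReal_cpow_neg (by linarith) s)).const_mul _)

theorem differentiableOn_oddTerm {x : ℝ} (hx : 0 < x) (hx1 : x < 1) (n : ℕ) :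
    DifferentiableOn ℂ (oddTerm x n) oddDomain := fun s _ =>
  (hasDerivAt_oddTerm hx hx1 n s).differentiableAt.differentiableWithinAt

theorem tendsto_ofReal_nat_add_cpow_neg {s : ℂ} (hs : 0 < s.re) (k : ℕ) :
    Tendsto (fun n : ℕ => ((n + k + 1 : ℝ) : ℂ) ^ (-s)) atTop (𝓝 0) := by
  rw [tendsto_zero_iff_norm_tendsto_zero]
  have h : ∀ n : ℕ, ‖((n + k + 1 : ℝ) : ℂ) ^ (-s)‖ = ((n + k + 1 : ℝ)) ^ (-s.re) := fun n => by
    rw [Complex.norm_cpow_eq_rpow_re_of_pos (by positivity)]; simp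
  simp_rw [h]
  refine (tendsto_rpow_neg_atTop hs).comp ?_
  have := tendsto_natCast_atTop_atTop (R := ℝ)
  exact tendsto_atTop_add_const_right _ _ (tendsto_atTop_add_const_right _ _ this)

/-- The correction terms in `oddTerm` telescope. -/
theorem sum_oddTerm (x : ℝ) (s : ℂ) (N : ℕ) :
    ∑ n ∈ Finset.range N, oddTerm x n s =
      ∑ n ∈ Finset.range N, (((n + x : ℝ) : ℂ) ^ (-s) - ((n + (1 - x) : ℝ) : ℂ) ^ (-s)) -
        (((1 - x : ℝ) : ℂ) - x) * (1 - ((N + 1 : ℝ) : ℂ) ^ (-s)) := by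
  have h := Finset.sum_range_sub' (fun n : ℕ => ((n + 1 : ℝ) : ℂ) ^ (-s)) N
  simp only [oddTerm]
  rw [Finset.sum_sub_distrib, ← Finset.mul_sum]
  congr 2
  convert! h using 2 with n
  · push_cast; ring_nf
  · simp

/-- Near `s = 2` the Dirichlet series converges and the telescoped correction tends to `1 - 2 * x`;
the identity theorem carries the equality over the connected domain. -/
theorem tsum_oddTerm {x : ℝ} (hx : 0 < x) (hx1 : x < 1) {s : ℂ} (hs : s ∈ oddDomain) :
    ∑' n, oddTerm x n s = 2 * HurwitzZeta.hurwitzZetaOdd x s - (1 - 2 * x) := by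
  have han : AnalyticOnNhd ℂ (fun s => ∑' n, oddTerm x n s) oddDomain :=
    (Complex.differentiableOn_tsum_of_summable_norm (summable_oddTerm_bound x)
      (differentiableOn_oddTerm hx hx1) isOpen_oddDomain
      (fun n s hs => norm_oddTerm_le hx hx1 n hs)).analyticOnNhd isOpen_oddDomain
  have hbn : AnalyticOnNhd ℂ (fun s => 2 * HurwitzZeta.hurwitzZetaOdd x s - (1 - 2 * x))
      oddDomain :=
    (((HurwitzZeta.differentiable_hurwitzZetaOdd x).const_mul 2).sub_const
      _).differentiableOn.analyticOnNhd isOpen_oddDomain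
  have h2 : (2 : ℂ) ∈ oddDomain := ⟨by simp; norm_num, by simp; norm_num⟩
  refine han.eqOn_of_preconnected_of_eventuallyEq hbn isPreconnected_oddDomain h2 ?_ hs
  have ho : {s : ℂ | 1 < s.re} ∈ 𝓝 (2 : ℂ) :=
    (isOpen_lt continuous_const Complex.continuous_re).mem_nhds (by simp)
  filter_upwards [ho, isOpen_oddDomain.mem_nhds h2] with w hw hwD
  have t1 := (Summable.of_norm_bounded (summable_oddTerm_bound x)
    (fun n => norm_oddTerm_le hx hx1 n hwD)).hasSum.tendsto_sum_nat
  refine tendsto_nhds_unique t1 ?_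
  simp_rw [sum_oddTerm]
  have t2 := ((HurwitzZeta.hasSum_nat_hurwitzZetaOdd_of_mem_Icc ⟨hx.le, hx1.le⟩
    hw).mul_left 2).tendsto_sum_nat
  have t3 := tendsto_ofReal_nat_add_cpow_neg (s := w) (zero_lt_one.trans hw) 0
  have t4 := t2.sub ((t3.const_sub 1).const_mul (((1 - x : ℝ) : ℂ) - x))
  convert! t4 using 2
  · congr 1
    · refine Finset.sum_congr rfl fun n _ => ?_
      rw [Complex.cpow_neg, Complex.cpow_neg]
      push_cast
      rw [add_sub_assoc]
      ring
    · simp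
  · push_cast; ring

/-! ### Value at `1` and derivative at `0` -/

theorem one_mem_oddDomain : (1 : ℂ) ∈ oddDomain := ⟨by simp; norm_num, by simp⟩
theorem zero_mem_oddDomain : (0 : ℂ) ∈ oddDomain := ⟨by simp; norm_num, by simp⟩

theorem ofReal_mem_integerComplement {x : ℝ} (hx : 0 < x) (hx1 : x < 1) :
    (x : ℂ) ∈ Complex.integerComplement := by
  rintro ⟨n, hn⟩
  have h : (n : ℝ) = x := by exact_mod_cast hn
  rw [← h] at hx hx1
  have h0 : 0 < n := by exact_mod_cast hx
  have h1 : n < 1 := by exact_mod_cast hx1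
  omega

theorem hurwitzZetaOdd_one {x : ℝ} (hx : 0 < x) (hx1 : x < 1) :
    2 * HurwitzZeta.hurwitzZetaOdd x 1 = Real.pi * Complex.cot (Real.pi * x) := by
  have t1 := (Summable.of_norm_bounded (summable_oddTerm_bound x)
    (fun n => norm_oddTerm_le hx hx1 n one_mem_oddDomain)).hasSum.tendsto_sum_nat
  rw [tsum_oddTerm hx hx1 one_mem_oddDomain] at t1
  have t2 := tendsto_logDeriv_euler_cot_sub (ofReal_mem_integerComplement hx hx1)
  have t3 := tendsto_ofReal_nat_add_cpow_neg (s := 1) (by simp) 0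
  have t5 : Tendsto (fun n : ℕ => (1 / ((n : ℂ) + x))) atTop (𝓝 0) := by
    rw [tendsto_zero_iff_norm_tendsto_zero]
    have h : ∀ n : ℕ, ‖1 / ((n : ℂ) + x)‖ = ((n : ℝ) + x)⁻¹ := fun n => by
      rw [← Complex.ofReal_natCast, ← Complex.ofReal_add, norm_div, Complex.norm_real,
        Real.norm_of_nonneg (by positivity)]; simp
    simp_rw [h]
    exact tendsto_inv_atTop_zero.comp
      (tendsto_atTop_add_const_right _ _ (tendsto_natCast_atTop_atTop (R := ℝ)))
  have t4 := (t2.sub t5).sub ((t3.const_sub 1).const_mul (((1 - x : ℝ) : ℂ) - x))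
  -- Each cotangent term pairs `n + 1 + x` with `n + 1 - x`, one index off from the series here; the
  -- surplus `1 / (N + x)` tends to `0`.
  have hpart : ∀ N : ℕ, ∑ n ∈ Finset.range N,
      (((n + x : ℝ) : ℂ) ^ (-1 : ℂ) - ((n + (1 - x) : ℝ) : ℂ) ^ (-1 : ℂ)) =
      1 / x + ∑ n ∈ Finset.range N, cotTerm x n - 1 / ((N : ℂ) + x) := fun N => by
    induction N with
    | zero => simp
    | succ k ih =>
      rw [Finset.sum_range_succ, Finset.sum_range_succ, ih, Complex.cpow_neg_one,
        Complex.cpow_neg_one]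
      have e : (x : ℂ) - (k + 1) = -((k + (1 - x) : ℝ) : ℂ) := by push_cast; ring
      have e2 : (x : ℂ) + (k + 1) = (k + 1 : ℕ) + x := by push_cast; ring
      simp only [cotTerm, e, e2, one_div, inv_neg]
      push_cast
      ring
  simp_rw [sum_oddTerm, hpart] at t1
  have := tendsto_nhds_unique t1 ((t4.const_add (1 / (x : ℂ))).congr fun N => ?_)
  · push_cast at this
    linear_combination this
  · simp
    ring

theorem deriv_hurwitzZetaOdd_zero {x : ℝ} (hx : 0 < x) (hx1 : x < 1) :
    2 * deriv (HurwitzZeta.hurwitzZetaOdd x) 0 =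
      ((Real.log (Real.Gamma x) - Real.log (Real.Gamma (1 - x)) : ℝ) : ℂ) := by
  have t1 := (Complex.hasSum_deriv_of_summable_norm (summable_oddTerm_bound x)
    (differentiableOn_oddTerm hx hx1) isOpen_oddDomain
    (fun n s hs => norm_oddTerm_le hx hx1 n hs) zero_mem_oddDomain).tendsto_sum_nat
  have hev : (fun s => ∑' n, oddTerm x n s) =ᶠ[𝓝 0]
      fun s => 2 * HurwitzZeta.hurwitzZetaOdd x s - (1 - 2 * x) :=
    Filter.eventually_of_mem (isOpen_oddDomain.mem_nhds zero_mem_oddDomain)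
      fun s hs => tsum_oddTerm hx hx1 hs
  have hd : deriv (fun s => 2 * HurwitzZeta.hurwitzZetaOdd x s - (1 - 2 * x)) 0 =
      2 * deriv (HurwitzZeta.hurwitzZetaOdd x) 0 := by
    rw [deriv_sub_const, deriv_const_mul _ (HurwitzZeta.differentiable_hurwitzZetaOdd x 0)]
  rw [hev.deriv_eq, hd] at t1
  have t2 := ((Real.BohrMollerup.tendsto_log_gamma hx).sub
    (Real.BohrMollerup.tendsto_log_gamma (sub_pos.mpr hx1)))
  -- `logGammaSeq x N` contains `N + 1` logarithms, hence the range; in the difference for `x` and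
  -- `1 - x` the factorials cancel.
  have hs : ∀ N : ℕ, ∑ n ∈ Finset.range (N + 1), deriv (oddTerm x n) 0 =
      ((Real.BohrMollerup.logGammaSeq x N - Real.BohrMollerup.logGammaSeq (1 - x) N
        + (1 - 2 * x) * (Real.log N - Real.log (N + 2 : ℝ)) : ℝ) : ℂ) := fun N => by
    have hdt : ∀ n : ℕ, deriv (oddTerm x n) 0 = ((-(Real.log (x + n) - Real.log (1 - x + n)) +
      (1 - 2 * x) * (Real.log (n + 1) - Real.log ((n + 1 : ℕ) + 1)) : ℝ) : ℂ) := fun n => by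
      rw [(hasDerivAt_oddTerm hx hx1 n 0).deriv]
      simp only [neg_zero, Complex.cpow_zero, mul_one, Nat.cast_add, Nat.cast_one]
      rw [add_comm x, add_comm (1 - x), add_assoc _ (1 : ℝ) 1, one_add_one_eq_two]
      push_cast
      ring
    have ht := Finset.sum_range_sub' (fun n : ℕ => Real.log (n + 1)) (N + 1)
    simp_rw [hdt]
    rw [← Complex.ofReal_sum, Finset.sum_add_distrib, ← Finset.mul_sum, ht,
      Finset.sum_neg_distrib, Finset.sum_sub_distrib, Real.BohrMollerup.logGammaSeq,
      Real.BohrMollerup.logGammaSeq]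
    congr 1
    have : ((N + 1 : ℕ) : ℝ) + 1 = N + 2 := by push_cast; ring
    rw [this]
    simp only [CharP.cast_eq_zero, zero_add, Real.log_one]
    ring
  have t3 : Tendsto (fun N : ℕ => Real.log N - Real.log (N + 2 : ℝ)) atTop (𝓝 0) := by
    have a1 := Real.tendsto_log_nat_add_one_sub_log
    have a2 := (a1.comp (tendsto_add_atTop_nat 1)).add a1
    convert! a2.neg using 2 with N
    · simp only [Function.comp_apply, Nat.cast_add, Nat.cast_one]
      rw [add_assoc _ (1 : ℝ) 1, one_add_one_eq_two]; ring
    · simp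
  have t4 := (Complex.continuous_ofReal.tendsto _).comp (t2.add (t3.const_mul (1 - 2 * x)))
  have t5 := t1.comp (tendsto_add_atTop_nat 1)
  refine tendsto_nhds_unique t5 ?_
  convert! t4 using 2 with N
  · exact funext hs
  · simp

/-! ### The sine zeta function at rational arguments -/

/-- Both sides are the L-function of the odd function `k ↦ sin (2πkp/q)` on `ZMod q`: one via
additive characters, the other by residue classes. -/
theorem sinZeta_div_eq_sum {p q : ℕ} (hp : 0 < p) (hpq : p < q) (s : ℂ) :
    HurwitzZeta.sinZeta ((p / q : ℝ) : UnitAddCircle) s = (q : ℂ) ^ (-s) *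
      ∑ j ∈ Finset.Ico 1 q, (Real.sin (2 * Real.pi * j * p / q) : ℂ) *
        HurwitzZeta.hurwitzZetaOdd ((j / q : ℝ) : UnitAddCircle) s := by
  have : NeZero q := ⟨by omega⟩
  have hp0 : (p : ZMod q) ≠ 0 := by
    rw [Ne, ZMod.natCast_eq_zero_iff]
    exact Nat.not_dvd_of_pos_of_lt hp hpq
  set Φ : ZMod q → ℂ := fun k =>
    (ZMod.stdAddChar ((p : ZMod q) * k) - ZMod.stdAddChar (-(p : ZMod q) * k)) / (2 * Complex.I)
    with hΦ
  have hodd : Φ.Odd := fun k => by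
    simp only [hΦ, neg_mul, mul_neg, neg_neg]
    ring
  have hL : ZMod.LFunction Φ s = HurwitzZeta.sinZeta ((p / q : ℝ) : UnitAddCircle) s := by
    rw [HurwitzZeta.sinZeta_eq, ← ZMod.toAddCircle_natCast, ← map_neg,
      ← ZMod.LFunction_stdAddChar_eq_expZeta _ _ (Or.inl hp0),
      ← ZMod.LFunction_stdAddChar_eq_expZeta _ _ (Or.inl (neg_ne_zero.mpr hp0))]
    simp only [ZMod.LFunction, hΦ]
    rw [← mul_sub, ← Finset.sum_sub_distrib, mul_div_assoc, Finset.sum_div]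
    congr 1
    refine Finset.sum_congr rfl fun k _ => by ring
  have hval : ∀ k : ZMod q, Φ k = (Real.sin (2 * Real.pi * k.val * p / q) : ℂ) := fun k => by
    have e1 : (p : ZMod q) * k = ((p * k.val : ℤ) : ZMod q) := by simp
    have e2 : -(p : ZMod q) * k = ((-(p * k.val) : ℤ) : ZMod q) := by simp
    simp only [hΦ]
    rw [e1, e2, ZMod.stdAddChar_coe, ZMod.stdAddChar_coe, Complex.ofReal_sin, Complex.sin]
    have a1 : 2 * (Real.pi : ℂ) * Complex.I * ((p * k.val : ℤ) : ℂ) / q =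
        ((2 * Real.pi * k.val * p / q : ℝ) : ℂ) * Complex.I := by push_cast; ring
    have a2 : 2 * (Real.pi : ℂ) * Complex.I * ((-(p * k.val) : ℤ) : ℂ) / q =
        -((2 * Real.pi * k.val * p / q : ℝ) : ℂ) * Complex.I := by push_cast; ring
    rw [a1, a2]
    field_simp
    rw [Complex.I_sq]
    ring
  rw [← hL, ZMod.LFunction_def_odd hodd]
  congr 1
  simp_rw [hval, ZMod.toAddCircle_apply]
  -- `ZMod (m + 1)` unfolds to `Fin (m + 1)`, which gives a range sum; its term `j = 0` vanishes
  -- with the sine.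
  obtain ⟨m, rfl⟩ : ∃ m, q = m + 1 := ⟨q - 1, by omega⟩
  refine (Fin.sum_univ_eq_sum_range (fun j : ℕ =>
    (Real.sin (2 * Real.pi * j * p / (m + 1 : ℕ)) : ℂ) *
        HurwitzZeta.hurwitzZetaOdd ((j / (m + 1 : ℕ) : ℝ) : UnitAddCircle) s) (m + 1)).trans ?_
  rw [Finset.range_eq_Ico, Finset.sum_eq_sum_Ico_succ_bot (by omega)]
  simp

/-! ### The functional equation to first order -/

/-- The factor of the functional equation of `hurwitzZetaOdd`, in a form regular at `0`. -/
theorem Gamma_mul_sin_eq {s : ℂ} (hs : s ≠ 0) (hs1 : ‖s‖ < 1) :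
    2 * Complex.Gamma s * Complex.sin (Real.pi * s / 2) =
      Real.pi / (Complex.cos (Real.pi * s / 2) * Complex.Gamma (1 - s)) := by
  have hsin : Complex.sin (Real.pi * s) ≠ 0 := by
    refine sin_pi_mul_ne_zero ?_
    rintro ⟨n, rfl⟩
    rw [Complex.norm_intCast] at hs1
    have : |n| < 1 := by exact_mod_cast hs1
    rw [Int.abs_lt_one_iff] at this
    simp [this] at hs
  have h := Complex.Gamma_mul_Gamma_one_sub s
  have h2 : Complex.sin (Real.pi * s) =
      2 * Complex.sin (Real.pi * s / 2) * Complex.cos (Real.pi * s / 2) := by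
    rw [← Complex.sin_two_mul]; congr 1; ring
  rw [eq_div_iff hsin, h2] at h
  rw [h2] at hsin
  have hc : Complex.cos (Real.pi * s / 2) ≠ 0 := right_ne_zero_of_mul hsin
  have hG : Complex.Gamma (1 - s) ≠ 0 := fun h0 => by
    rw [h0, mul_zero, zero_mul] at h
    exact Real.pi_ne_zero (by exact_mod_cast h.symm)
  rw [eq_div_iff (mul_ne_zero hc hG)]
  linear_combination h

theorem hasDerivAt_oddFactor :
    HasDerivAt (fun s : ℂ => (2 * (Real.pi : ℂ)) ^ (-s) *
      (Real.pi / (Complex.cos (Real.pi * s / 2) * Complex.Gamma (1 - s))))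
      (-(Real.pi * (Real.log (2 * Real.pi) + Real.eulerMascheroniConstant))) 0 := by
  have h1 := hasDerivAt_ofReal_cpow_neg Real.two_pi_pos 0
  have h2 : HasDerivAt (fun s : ℂ => Complex.cos (Real.pi * s / 2)) 0 0 := by
    have := (((hasDerivAt_id (0 : ℂ)).const_mul (Real.pi : ℂ)).div_const 2).ccos
    simpa using this
  have h3 : HasDerivAt (fun s : ℂ => Complex.Gamma (1 - s)) Real.eulerMascheroniConstant 0 := by
    have := HasDerivAt.comp_const_sub (1 : ℂ) 0 (by simpa using Complex.hasDerivAt_Gamma_one)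
    simpa using this
  have h4 := h1.fun_mul ((hasDerivAt_const (0 : ℂ) (Real.pi : ℂ)).fun_div (h2.fun_mul h3) (by simp))
  simp only [Complex.ofReal_mul, Complex.ofReal_ofNat] at h4
  refine h4.congr_deriv ?_
  simp
  ring

/-- The functional equation is available only for `s ≠ 0`, but with the regularised factor both
sides are differentiable at `0`, so values and derivatives agree there too. -/
theorem hurwitzZetaOdd_one_and_deriv_eq_sinZeta (a : UnitAddCircle) :
    HurwitzZeta.hurwitzZetaOdd a 1 = Real.pi * HurwitzZeta.sinZeta a 0 ∧
    deriv (HurwitzZeta.hurwitzZetaOdd a) 1 =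
      Real.pi * (Real.log (2 * Real.pi) + Real.eulerMascheroniConstant) * HurwitzZeta.sinZeta a 0 -
        Real.pi * deriv (HurwitzZeta.sinZeta a) 0 := by
  have hF := hasDerivAt_oddFactor.fun_mul (HurwitzZeta.differentiableAt_sinZeta a 0).hasDerivAt
  have hO : HasDerivAt (fun s => HurwitzZeta.hurwitzZetaOdd a (1 - s))
      (-deriv (HurwitzZeta.hurwitzZetaOdd a) 1) 0 := by
    have := HasDerivAt.comp_const_sub (1 : ℂ) 0
      (HurwitzZeta.differentiable_hurwitzZetaOdd a (1 - 0)).hasDerivAt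
    simpa using this
  have hev : (fun s => HurwitzZeta.hurwitzZetaOdd a (1 - s)) =ᶠ[𝓝[≠] 0]
      fun s : ℂ => (2 * (Real.pi : ℂ)) ^ (-s) *
      (Real.pi / (Complex.cos (Real.pi * s / 2) * Complex.Gamma (1 - s))) *
        HurwitzZeta.sinZeta a s := by
    filter_upwards [self_mem_nhdsWithin,
      nhdsWithin_le_nhds (Metric.ball_mem_nhds (0 : ℂ) one_pos)] with s hs hs1
    have hs1 : ‖s‖ < 1 := by simpa using hs1
    rw [HurwitzZeta.hurwitzZetaOdd_one_sub a, ← Gamma_mul_sin_eq hs hs1]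
    · ring
    · rintro n rfl
      rw [norm_neg, Complex.norm_natCast] at hs1
      have : n < 1 := by exact_mod_cast hs1
      simp [Nat.lt_one_iff.mp this] at hs
  have hev' := (ContinuousAt.eventuallyEq_nhds_iff_eventuallyEq_nhdsNE hO.continuousAt
    hF.continuousAt).mp hev
  constructor
  · simpa using hev'.eq_of_nhds
  · have := hO.unique (hF.congr_of_eventuallyEq hev')
    simp at this
    linear_combination -this

/-! ### Assembly -/

theorem two_mul_deriv_hurwitzZetaOdd_one {p q : ℕ} (hp : 0 < p) (hpq : p < q) :
    2 * deriv (HurwitzZeta.hurwitzZetaOdd ((p / q : ℝ) : UnitAddCircle)) 1 =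
      ((Real.pi * (Real.log (2 * Real.pi * (q : ℝ)) + Real.eulerMascheroniConstant)
              * Real.cot (Real.pi * (p : ℝ) / (q : ℝ))
            - 2 * Real.pi * ∑ j ∈ Finset.Ico 1 q,
                Real.log (Real.Gamma ((j : ℝ) / (q : ℝ)))
                  * Real.sin (2 * Real.pi * (j : ℝ) * (p : ℝ) / (q : ℝ)) : ℝ) : ℂ) := by
  have hq : (0 : ℝ) < q := by exact_mod_cast hp.trans hpq
  have hmem : ∀ j ∈ Finset.Ico 1 q, 0 < (j : ℝ) / q ∧ (j : ℝ) / q < 1 := fun j hj => by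
    rw [Finset.mem_Ico] at hj
    have : (0 : ℝ) < j := by exact_mod_cast hj.1
    exact ⟨by positivity, (div_lt_one hq).mpr (by exact_mod_cast hj.2)⟩
  obtain ⟨hx, hx1⟩ := hmem p (Finset.mem_Ico.mpr ⟨hp, hpq⟩)
  obtain ⟨h1, h2⟩ := hurwitzZetaOdd_one_and_deriv_eq_sinZeta ((p / q : ℝ) : UnitAddCircle)
  have hcot := hurwitzZetaOdd_one hx hx1
  have hS : HurwitzZeta.sinZeta ((p / q : ℝ) : UnitAddCircle) 0 =
      (Real.cot (Real.pi * p / q) : ℂ) / 2 := by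
    have e : (Real.pi : ℂ) * ((p / q : ℝ) : ℂ) = ((Real.pi * p / q : ℝ) : ℂ) := by
      push_cast; ring
    rw [h1, e, ← Complex.ofReal_cot] at hcot
    have hpi : (Real.pi : ℂ) ≠ 0 := by exact_mod_cast Real.pi_ne_zero
    refine mul_left_cancel₀ hpi ?_
    linear_combination hcot / 2
  have hsum : HasDerivAt (fun s => ∑ j ∈ Finset.Ico 1 q,
      (Real.sin (2 * Real.pi * j * p / q) : ℂ) *
        HurwitzZeta.hurwitzZetaOdd ((j / q : ℝ) : UnitAddCircle) s)
      (∑ j ∈ Finset.Ico 1 q, (Real.sin (2 * Real.pi * j * p / q) : ℂ) *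
        deriv (HurwitzZeta.hurwitzZetaOdd ((j / q : ℝ) : UnitAddCircle)) 0) 0 :=
    HasDerivAt.fun_sum fun j _ =>
      (HurwitzZeta.differentiable_hurwitzZetaOdd _ 0).hasDerivAt.const_mul _
  have hD := ((hasDerivAt_ofReal_cpow_neg hq 0).fun_mul hsum).deriv
  rw [Complex.ofReal_natCast, ← funext (sinZeta_div_eq_sum hp hpq), neg_zero, Complex.cpow_zero,
    mul_one, one_mul] at hD
  have hS0 := sinZeta_div_eq_sum hp hpq 0
  rw [neg_zero, Complex.cpow_zero, one_mul] at hS0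
  rw [← hS0, hS] at hD
  -- The reflection `j ↦ q - j` flips the sine, so the two `log Γ` sums add up and absorb the factor
  -- `1/2`.
  have hrefl : ∑ j ∈ Finset.Ico 1 q, Real.sin (2 * Real.pi * j * p / q) *
      Real.log (Real.Gamma (1 - j / q)) =
      -∑ j ∈ Finset.Ico 1 q, Real.sin (2 * Real.pi * j * p / q) *
        Real.log (Real.Gamma (j / q)) := by
    rw [← Finset.sum_neg_distrib]
    refine Finset.sum_nbij' (fun j => q - j) (fun j => q - j) ?_ ?_ ?_ ?_ ?_
    · intro j hj; rw [Finset.mem_Ico] at *; omega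
    · intro j hj; rw [Finset.mem_Ico] at *; omega
    · intro j hj; rw [Finset.mem_Ico] at hj; omega
    · intro j hj; rw [Finset.mem_Ico] at hj; omega
    · intro j hj
      rw [Finset.mem_Ico] at hj
      rw [Nat.cast_sub hj.2.le, sub_div, div_self hq.ne', ← neg_mul]
      congr 1
      have : 2 * Real.pi * ((q : ℝ) - j) * p / q =
          (p : ℝ) * (2 * Real.pi) - 2 * Real.pi * j * p / q := by field_simp
      rw [this, Real.sin_nat_mul_two_pi_sub, neg_neg]
  have hder : ∑ j ∈ Finset.Ico 1 q, (Real.sin (2 * Real.pi * j * p / q) : ℂ) *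
        deriv (HurwitzZeta.hurwitzZetaOdd ((j / q : ℝ) : UnitAddCircle)) 0 =
      ((∑ j ∈ Finset.Ico 1 q, Real.log (Real.Gamma (j / q)) *
        Real.sin (2 * Real.pi * j * p / q) : ℝ) : ℂ) := by
    have a : ∀ j ∈ Finset.Ico 1 q, (Real.sin (2 * Real.pi * j * p / q) : ℂ) *
        deriv (HurwitzZeta.hurwitzZetaOdd ((j / q : ℝ) : UnitAddCircle)) 0 =
        (((Real.sin (2 * Real.pi * j * p / q) * Real.log (Real.Gamma (j / q)) -
          Real.sin (2 * Real.pi * j * p / q) * Real.log (Real.Gamma (1 - j / q))) / 2 : ℝ) : ℂ) :=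
      fun j hj => by
        have := deriv_hurwitzZetaOdd_zero (hmem j hj).1 (hmem j hj).2
        push_cast at this ⊢
        linear_combination (Complex.sin (2 * Real.pi * j * p / q)) / 2 * this
    rw [Finset.sum_congr rfl a, ← Complex.ofReal_sum, ← Finset.sum_div, Finset.sum_sub_distrib,
      hrefl]
    simp_rw [mul_comm (Real.log _)]
    congr 1
    ring
  rw [hder] at hD
  -- The `log q` from differentiating `q ^ (-s)` joins `log (2π)` from the functional equation.
  rw [h2, hS, hD, Real.log_mul (by positivity) hq.ne']
  push_cast
  ring

theorem hurwitzZeta_sub_hurwitzZeta_one_sub (u : ℝ) (s : ℂ) :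
    HurwitzZeta.hurwitzZeta (u : UnitAddCircle) s -
      HurwitzZeta.hurwitzZeta ((1 - u : ℝ) : UnitAddCircle) s =
      2 * HurwitzZeta.hurwitzZetaOdd (u : UnitAddCircle) s := by
  have : ((1 - u : ℝ) : UnitAddCircle) = -(u : UnitAddCircle) := by
    rw [AddCircle.coe_sub, AddCircle.coe_period, zero_sub]
  rw [this, HurwitzZeta.hurwitzZetaOdd_eq]
  ring

/-- The terms `1 / (s - 1)` cancel off `s = 1`; continuity fills in that point. -/
theorem hurwitzRegularPart_sub (u : ℝ) :
    (fun s => hurwitzRegularPart u s - hurwitzRegularPart (1 - u) s) =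
      fun s => 2 * HurwitzZeta.hurwitzZetaOdd (u : UnitAddCircle) s := by
  refine Continuous.ext_on (dense_compl_singleton (1 : ℂ))
    ((differentiable_hurwitzRegularPart u).continuous.sub
      (differentiable_hurwitzRegularPart (1 - u)).continuous)
    (continuous_const.mul (HurwitzZeta.differentiable_hurwitzZetaOdd _).continuous) ?_
  intro s hs
  have hs : s ≠ 1 := hs
  simp only [hurwitzRegularPart, Function.update_of_ne hs]
  rw [← hurwitzZeta_sub_hurwitzZeta_one_sub]
  ring

theorem mainTheorem4 (p q : ℕ) (hp : 0 < p) (hpq : p < q) :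
    Tendsto
      (fun s : ℂ =>
        deriv (HurwitzZeta.hurwitzZeta (((p : ℝ) / (q : ℝ) : ℝ) : UnitAddCircle)) s
          - deriv (HurwitzZeta.hurwitzZeta ((1 - (p : ℝ) / (q : ℝ) : ℝ) : UnitAddCircle)) s)
      (𝓝[≠] (1 : ℂ))
      (𝓝 ((Real.pi * (Real.log (2 * Real.pi * (q : ℝ)) + Real.eulerMascheroniConstant)
              * Real.cot (Real.pi * (p : ℝ) / (q : ℝ))
            - 2 * Real.pi * ∑ j ∈ Finset.Ico 1 q,
                Real.log (Real.Gamma ((j : ℝ) / (q : ℝ)))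
                  * Real.sin (2 * Real.pi * (j : ℝ) * (p : ℝ) / (q : ℝ)) : ℝ) : ℂ)) ∧
    stieltjesConst 1 ((p : ℝ) / (q : ℝ)) - stieltjesConst 1 (1 - (p : ℝ) / (q : ℝ))
      = ((-(Real.pi * (Real.log (2 * Real.pi * (q : ℝ)) + Real.eulerMascheroniConstant)
              * Real.cot (Real.pi * (p : ℝ) / (q : ℝ))
            - 2 * Real.pi * ∑ j ∈ Finset.Ico 1 q,
                Real.log (Real.Gamma ((j : ℝ) / (q : ℝ)))
                  * Real.sin (2 * Real.pi * (j : ℝ) * (p : ℝ) / (q : ℝ))) : ℝ) : ℂ) := by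
  have key := two_mul_deriv_hurwitzZetaOdd_one hp hpq
  constructor
  · rw [← key]
    have hO := HurwitzZeta.differentiable_hurwitzZetaOdd (((p : ℝ) / q : ℝ) : UnitAddCircle)
    have hc : Continuous (deriv (HurwitzZeta.hurwitzZetaOdd (((p : ℝ) / q : ℝ) : UnitAddCircle))) :=
      (hO.contDiff (n := 1)).continuous_deriv le_rfl
    refine (((hc.tendsto 1).const_mul 2).mono_left nhdsWithin_le_nhds).congr' ?_
    filter_upwards [self_mem_nhdsWithin] with s hs
    have hd := ((HurwitzZeta.differentiableAt_hurwitzZeta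
        (((p : ℝ) / q : ℝ) : UnitAddCircle) hs).hasDerivAt.fun_sub
      (HurwitzZeta.differentiableAt_hurwitzZeta
        ((1 - (p : ℝ) / q : ℝ) : UnitAddCircle) hs).hasDerivAt)
    rw [funext (hurwitzZeta_sub_hurwitzZeta_one_sub ((p : ℝ) / q))] at hd
    rw [← hd.deriv, deriv_const_mul _ (hO s)]
  · have hd := ((differentiable_hurwitzRegularPart ((p : ℝ) / q) 1).hasDerivAt.fun_sub
      (differentiable_hurwitzRegularPart (1 - (p : ℝ) / q) 1).hasDerivAt)
    rw [hurwitzRegularPart_sub] at hd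
    have h2 := hd.deriv
    rw [deriv_const_mul _ (HurwitzZeta.differentiable_hurwitzZetaOdd _ 1), key] at h2
    simp only [stieltjesConst, iteratedDeriv_one, pow_one]
    rw [Complex.ofReal_neg, h2]
    ring
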